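/- Let $\mathcal H$ and $\mathcal K$ be complex Hilbert spaces, and let $A_1,\dots,A_m\in\mathcal B(\mathcal H)$ and $B_1,\dots,B_m\in\mathcal B(\mathcal K)$ be self-adjoint operators. Put $\mathcal S=\operatorname{span}_{\mathbb C}\{I,A_1,\dots,A_m\}$ and consider the linear map $\Phi:\mathcal S\to\mathcal B(\mathcal K)$ given by $$\Phi(\mu_0 I+\mu_1A_1+\cdots+\mu_mA_m)=\mu_0 I+\mu_1B_1+\cdots+\mu_mB_m\qquad(\mu_0,\dots,\mu_m\in\mathbb C),$$ assuming that this is well defined. The joint numerical range of operators $T_1,\dots,T_m$ is $W(T_1,\dots,T_m)=\{(\langle T_1x,x\rangle,\dots,\langle T_mx,x\rangle):\langle x,x\rangle=1\}$. The map $\Phi$ is positive if it sends positive semidefinite operators in $\mathcal S$ to positive semidefinite operators, and completely positive if for every $k\ge1$ the map $(S_{ij})\mapsto(\Phi(S_{ij}))$ sends each positive semidefinite $(S_{ij})\in M_k(\mathcal S)$, regarded as an operator on $\mathcal H^k$, to a positive semidefinite operator on $\mathcal K^k$. We say that $(B_1,\dots,B_m)$ has a joint dilation of the form $(A_1\otimes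 I,\dots,A_m\otimes I)$ if there are a Hilbert space $\mathcal L$ and an isometry $V:\mathcal K\to\mathcal H\otimes\mathcal L$ (Hilbert space tensor product) with $V^*(A_j\otimes I_{\mathcal L})V=B_j$ for $j=1,\dots,m$. (a) $\Phi$ is positive if and only if $W(B_1,\dots,B_m)\subseteq\overline{\operatorname{conv}}\,W(A_1,\dots,A_m)$, the closure of the convex hull. (b) If $(B_1,\dots,B_m)$ has a joint dilation of the form $(A_1\otimes I,\dots,A_m\otimes I)$, then $\Phi$ is completely positive. Conversely, if $\Phi$ is completely positive and $\dim\mathcal H<\infty$, then $(B_1,\dots,B_m)$ has a joint dilation of the form $(A_1\otimes I,\dots,A_m\otimes I)$. Moreover, $\Phi$ is well defined whenever the inclusion in (a) holds, and whenever a joint dilation of the form $(A_1\otimes I,\dots,A_m\otimes I)$ exists. -/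

import Mathlib

open scoped TensorProduct

universe u v w

noncomputable section

/-- The joint numerical range
`W(T₁, …, Tₘ) = {(⟨T₁ x, x⟩, …, ⟨Tₘ x, x⟩) : ⟨x, x⟩ = 1} ⊆ ℂᵐ`.
Mathlib's inner product is conjugate-linear in its first argument, so the number written
`⟨T x, x⟩` with an inner product linear in its first argument is `inner ℂ x (T x)`. -/
def jointNumericalRange {H : Type u} [NormedAddCommGroup H] [InnerProductSpace ℂ H]
    {m : ℕ} (T : Fin m → (H →L[ℂ] H)) : Set (Fin m → ℂ) :=
  {a | ∃ x : H, inner ℂ x x = (1 : ℂ) ∧ ∀ i, a i = inner ℂ x (T i x)}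

/-- The complex span of the identity and `A₁, …, Aₘ`. -/
def operatorSpan {H : Type u} [NormedAddCommGroup H] [InnerProductSpace ℂ H]
    {m : ℕ} (A : Fin m → (H →L[ℂ] H)) : Submodule ℂ (H →L[ℂ] H) :=
  Submodule.span ℂ (insert 1 (Set.range A))

/-- `Φ` is given on `span {I, A₁, …, Aₘ}` by
`Φ(μ₀ I + μ₁ A₁ + ⋯ + μₘ Aₘ) = μ₀ I + μ₁ B₁ + ⋯ + μₘ Bₘ`. -/
def IsInducedMap {H : Type u} {K : Type v}
    [NormedAddCommGroup H] [InnerProductSpace ℂ H]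
    [NormedAddCommGroup K] [InnerProductSpace ℂ K] {m : ℕ}
    (A : Fin m → (H →L[ℂ] H)) (B : Fin m → (K →L[ℂ] K))
    (Φ : operatorSpan A →ₗ[ℂ] (K →L[ℂ] K)) : Prop :=
  ∀ (X : operatorSpan A) (μ₀ : ℂ) (μ : Fin m → ℂ),
    (X : H →L[ℂ] H) = μ₀ • (1 : H →L[ℂ] H) + ∑ i, μ i • A i →
      Φ X = μ₀ • (1 : K →L[ℂ] K) + ∑ i, μ i • B i

/-- A linear map on a space of operators is positive if it sends positive semidefinite
operators to positive semidefinite operators. -/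
def IsPositiveMap {H : Type u} {K : Type v}
    [NormedAddCommGroup H] [InnerProductSpace ℂ H]
    [NormedAddCommGroup K] [InnerProductSpace ℂ K]
    {S : Submodule ℂ (H →L[ℂ] H)} (Φ : S →ₗ[ℂ] (K →L[ℂ] K)) : Prop :=
  ∀ X : S, (X : H →L[ℂ] H).IsPositive → (Φ X).IsPositive

/-- A `k × k` matrix of operators on `H`, as an operator on the Hilbert space direct sum of
`k` copies of `H`: `(M x)ᵢ = ∑ⱼ Mᵢⱼ xⱼ`. -/
def blockOperator {H : Type u} [NormedAddCommGroup H] [InnerProductSpace ℂ H] {k : ℕ}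
    (M : Matrix (Fin k) (Fin k) (H →L[ℂ] H)) :
    PiLp 2 (fun _ : Fin k => H) →L[ℂ] PiLp 2 (fun _ : Fin k => H) :=
  (PiLp.continuousLinearEquiv 2 ℂ (fun _ : Fin k => H)).symm.toContinuousLinearMap ∘L
    (ContinuousLinearMap.pi fun i => ∑ j, M i j ∘L ContinuousLinearMap.proj j) ∘L
    (PiLp.continuousLinearEquiv 2 ℂ (fun _ : Fin k => H)).toContinuousLinearMap

/-- `Φ` is completely positive if, for every `k`, the entrywise map
`(Sᵢⱼ) ↦ (Φ(Sᵢⱼ))` on `k × k` matrices over `S` is positive. -/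
def IsCompletelyPositiveMap {H : Type u} {K : Type v}
    [NormedAddCommGroup H] [InnerProductSpace ℂ H]
    [NormedAddCommGroup K] [InnerProductSpace ℂ K]
    {S : Submodule ℂ (H →L[ℂ] H)} (Φ : S →ₗ[ℂ] (K →L[ℂ] K)) : Prop :=
  ∀ (k : ℕ) (M : Matrix (Fin k) (Fin k) S),
    (blockOperator (M.map fun X => (X : H →L[ℂ] H))).IsPositive →
      (blockOperator (M.map fun X => Φ X)).IsPositive

/-- The Hilbert space tensor product: the completion of the algebraic tensor product. -/
abbrev HilbertTensor (H : Type u) (L : Type w)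
    [NormedAddCommGroup H] [InnerProductSpace ℂ H]
    [NormedAddCommGroup L] [InnerProductSpace ℂ L] : Type (max u w) :=
  UniformSpace.Completion (H ⊗[ℂ] L)

/-- The operator `T ⊗ I` on the Hilbert space tensor product of `H` and `L`. -/
def tensorId {H : Type u} [NormedAddCommGroup H] [InnerProductSpace ℂ H]
    (L : Type w) [NormedAddCommGroup L] [InnerProductSpace ℂ L] (T : H →L[ℂ] H) :
    HilbertTensor H L →L[ℂ] HilbertTensor H L :=
  (TensorProduct.mapL T (ContinuousLinearMap.id ℂ L)).completion

/-- `(B₁, …, Bₘ)` on `K` has the joint dilation `(T₁, …, Tₘ)` on `G`: there is an isometry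
`V : K → G` with `V* Tⱼ V = Bⱼ` for all `j`. -/
def HasJointDilation {G : Type u} {K : Type v}
    [NormedAddCommGroup G] [InnerProductSpace ℂ G] [CompleteSpace G]
    [NormedAddCommGroup K] [InnerProductSpace ℂ K] [CompleteSpace K] {m : ℕ}
    (B : Fin m → (K →L[ℂ] K)) (T : Fin m → (G →L[ℂ] G)) : Prop :=
  ∃ V : K →ₗᵢ[ℂ] G, ∀ j,
    ContinuousLinearMap.adjoint V.toContinuousLinearMap ∘L T j ∘L V.toContinuousLinearMap = B j

/-- `(B₁, …, Bₘ)` has a joint dilation of the form `(A₁ ⊗ I, …, Aₘ ⊗ I)`, where `I` is the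
identity of some Hilbert space `L` (in the universe `w`). -/
def HasTensorDilation {H : Type u} {K : Type v}
    [NormedAddCommGroup H] [InnerProductSpace ℂ H]
    [NormedAddCommGroup K] [InnerProductSpace ℂ K] [CompleteSpace K] {m : ℕ}
    (B : Fin m → (K →L[ℂ] K)) (A : Fin m → (H →L[ℂ] H)) : Prop :=
  ∃ (L : Type w) (_ : NormedAddCommGroup L) (_ : InnerProductSpace ℂ L) (_ : CompleteSpace L),
    HasJointDilation B (fun j => tensorId L (A j))

end

/-! For (a), a closed half-space of real points `f ≥ c` corresponds to the self-adjoint combination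
with coefficients `-c, f(e_1), …, f(e_m)`: its quadratic form at a unit vector is `f - c` evaluated
at the numerical range point. Positivity of `Φ` thus transfers half-spaces containing `W(A)` to
half-spaces containing `W(B)`, and Hahn–Banach separation turns this into the inclusion.

For (b), a dilation gives `⟨x, Φ(X) y⟩ = ⟨Vx, (X ⊗ I) Vy⟩`, and tensoring with `I` preserves block
positivity (`sum_inner_tensorId_nonneg`). Conversely, complete positivity says that `Y ↦ ∑ ⟨x,
Φ(Y_xy) y⟩`, on finitely supported `K × K` matrices over the span, is nonnegative on the positive
cone. Riesz extension gives a positive functional `τ` on all operator matrices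
(`IsCompletelyPositiveMap.exists_extension`). Its values on rank-one entries form a positive kernel,
hence are inner products of vectors `f x i` (`exists_gram_of_positive_functional`). For an
orthonormal basis `e` of finite-dimensional `H`, `V x = ∑ e_i ⊗ f x i` is the dilating isometry. -/

section

/-! ### Numerical ranges and positivity -/

variable {H : Type u} {K : Type v}
  [NormedAddCommGroup H] [InnerProductSpace ℂ H]
  [NormedAddCommGroup K] [InnerProductSpace ℂ K] {m : ℕ}

/-- The linear map `(μ₀, μ) ↦ μ₀ I + μ₁ T₁ + ⋯ + μₘ Tₘ`. -/
noncomputable def operatorCombination (T : Fin m → (H →L[ℂ] H)) :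
    ℂ × (Fin m → ℂ) →ₗ[ℂ] (H →L[ℂ] H) :=
  LinearMap.coprod (LinearMap.toSpanSingleton ℂ _ 1) (Fintype.linearCombination ℂ T)

lemma operatorCombination_apply (T : Fin m → (H →L[ℂ] H)) (μ₀ : ℂ) (μ : Fin m → ℂ) :
    operatorCombination T (μ₀, μ) = μ₀ • (1 : H →L[ℂ] H) + ∑ i, μ i • T i := by
  simp [operatorCombination, Fintype.linearCombination_apply]

lemma mem_operatorSpan_iff {T : Fin m → (H →L[ℂ] H)} {X : H →L[ℂ] H} :
    X ∈ operatorSpan T ↔ ∃ μ₀ μ, X = operatorCombination T (μ₀, μ) := by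
  simp only [operatorSpan, Submodule.mem_span_insert, Submodule.mem_span_range_iff_exists_fun,
    operatorCombination_apply]
  constructor
  · rintro ⟨a, _, ⟨c, rfl⟩, rfl⟩
    exact ⟨a, c, rfl⟩
  · rintro ⟨a, c, rfl⟩
    exact ⟨a, _, ⟨c, rfl⟩, rfl⟩

lemma inner_operatorCombination (T : Fin m → (H →L[ℂ] H)) (μ₀ : ℂ) (μ : Fin m → ℂ) (x : H) :
    inner ℂ x (operatorCombination T (μ₀, μ) x) =
      μ₀ * inner ℂ x x + ∑ i, μ i * inner ℂ x (T i x) := by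
  simp [operatorCombination_apply]

lemma IsInducedMap.apply_operatorCombination {A : Fin m → (H →L[ℂ] H)} {B : Fin m → (K →L[ℂ] K)}
    {Φ : operatorSpan A →ₗ[ℂ] (K →L[ℂ] K)} (hΦ : IsInducedMap A B Φ) (X : operatorSpan A)
    {μ : ℂ × (Fin m → ℂ)} (hX : (X : H →L[ℂ] H) = operatorCombination A μ) :
    Φ X = operatorCombination B μ := by
  obtain ⟨μ₀, μ⟩ := μ
  rw [operatorCombination_apply] at *
  exact hΦ X μ₀ μ hX

/-- Lift `X` to coefficients by a linear section; any two lifts differ by an element of the kernel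
for `A`, which the combination for `B` also kills. -/
lemma IsInducedMap.exists_of_ker_le {A : Fin m → (H →L[ℂ] H)} {B : Fin m → (K →L[ℂ] K)}
    (h : ∀ μ, operatorCombination A μ = 0 → operatorCombination B μ = 0) :
    ∃ Φ : operatorSpan A →ₗ[ℂ] (K →L[ℂ] K), IsInducedMap A B Φ := by
  obtain ⟨g, hg⟩ := (operatorCombination A).rangeRestrict.exists_rightInverse_of_surjective
    (operatorCombination A).range_rangeRestrict
  have hle : operatorSpan A ≤ LinearMap.range (operatorCombination A) := fun X hX => by
    obtain ⟨μ₀, μ, rfl⟩ := mem_operatorSpan_iff.1 hX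
    exact ⟨_, rfl⟩
  refine ⟨operatorCombination B ∘ₗ g ∘ₗ Submodule.inclusion hle, fun X μ₀ μ hX => ?_⟩
  rw [← operatorCombination_apply] at hX ⊢
  have hgX : operatorCombination A (g (Submodule.inclusion hle X)) = X :=
    congrArg Subtype.val (LinearMap.congr_fun hg (Submodule.inclusion hle X))
  have := h (g (Submodule.inclusion hle X) - (μ₀, μ)) (by rw [map_sub, hgX, hX, sub_self])
  rw [map_sub, sub_eq_zero] at this
  exact this

lemma ContinuousLinearMap.isPositive_iff_inner_right {T : H →L[ℂ] H} :
    T.IsPositive ↔ ∀ x, 0 ≤ (inner ℂ x (T x)).re ∧ (inner ℂ x (T x)).im = 0 := by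
  rw [ContinuousLinearMap.isPositive_iff_complex]
  refine forall_congr' fun x => ?_
  rw [← inner_conj_symm (T x) x]
  simp only [Complex.ext_iff, Complex.conj_re, Complex.conj_im, Complex.ofReal_re,
    Complex.ofReal_im, RCLike.re_to_complex, true_and, zero_eq_neg, and_comm]

lemma ContinuousLinearMap.eq_zero_of_inner_right {T : H →L[ℂ] H}
    (h : ∀ x, inner ℂ x (T x) = 0) : T = 0 := by
  have := (inner_map_self_eq_zero (T : H →ₗ[ℂ] H)).1 fun x => by
    rw [← inner_conj_symm]; simp [h]
  ext x
  exact LinearMap.congr_fun this x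

lemma exists_inner_self_eq_one_smul {x : H} (hx : x ≠ 0) :
    ∃ (r : ℝ) (y : H), inner ℂ y y = (1 : ℂ) ∧ x = (r : ℂ) • y := by
  have hn : (‖x‖ : ℂ) ≠ 0 := by simpa using hx
  refine ⟨‖x‖, (‖x‖ : ℂ)⁻¹ • x, ?_, ?_⟩
  · rw [inner_self_eq_norm_sq_to_K, norm_smul]
    simp [hx]
  · rw [smul_inv_smul₀ hn]

section

variable [CompleteSpace H]

lemma IsSelfAdjoint.inner_self_im {T : H →L[ℂ] H} (hT : IsSelfAdjoint T) (x : H) :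
    (inner ℂ x (T x)).im = 0 := by
  have h : inner ℂ (T x) x = inner ℂ x (T x) := hT.isSymmetric x x
  rw [← Complex.conj_eq_iff_im, inner_conj_symm, h]

lemma star_operatorCombination {T : Fin m → (H →L[ℂ] H)} (hT : ∀ i, IsSelfAdjoint (T i))
    (μ : ℂ × (Fin m → ℂ)) :
    star (operatorCombination T μ) = operatorCombination T (star μ) := by
  obtain ⟨μ₀, μ⟩ := μ
  rw [Prod.star_def, operatorCombination_apply, operatorCombination_apply]
  simp [star_sum, fun i => (hT i).star_eq]

end

/-- A lower bound of a continuous real functional on a set holds on the closed convex hull. -/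
lemma le_of_mem_closure_convexHull {E : Type*} [NormedAddCommGroup E] [NormedSpace ℝ E]
    {s : Set E} (f : E →L[ℝ] ℝ) {c : ℝ} (h : ∀ a ∈ s, c ≤ f a) {a : E}
    (ha : a ∈ closure (convexHull ℝ s)) : c ≤ f a := by
  have hsub : closure (convexHull ℝ s) ⊆ {a | c ≤ f a} :=
    closure_minimal (convexHull_min h (convex_halfSpace_ge f.toLinearMap.isLinear c))
      (isClosed_le continuous_const f.continuous)
  exact hsub ha

/-- The real functional `a ↦ Re (∑ i, μ i * a i)`. -/
noncomputable def reWeightedSum (μ : Fin m → ℂ) : (Fin m → ℂ) →L[ℝ] ℝ :=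
  ∑ i, Complex.reCLM ∘L (ContinuousLinearMap.mul ℝ ℂ (μ i)) ∘L ContinuousLinearMap.proj i

lemma reWeightedSum_apply (μ a : Fin m → ℂ) : reWeightedSum μ a = (∑ i, μ i * a i).re := by
  simp [reWeightedSum]

/-- If `Re ⟨X x, x⟩ ≥ 0` for all `x` and `X` a combination of `A`, the same holds
for the corresponding combination of `B`, provided `W(B)` lies in the closed convex hull
of `W(A)`. -/
lemma re_inner_operatorCombination_nonneg {A : Fin m → (H →L[ℂ] H)} {B : Fin m → (K →L[ℂ] K)}
    (hW : jointNumericalRange B ⊆ closure (convexHull ℝ (jointNumericalRange A)))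
    {μ : ℂ × (Fin m → ℂ)} (hμ : ∀ x, 0 ≤ (inner ℂ x (operatorCombination A μ x)).re) (x : K) :
    0 ≤ (inner ℂ x (operatorCombination B μ x)).re := by
  obtain ⟨μ₀, μ⟩ := μ
  rcases eq_or_ne x 0 with rfl | hx
  · simp
  obtain ⟨r, y, hy, rfl⟩ := exists_inner_self_eq_one_smul hx
  -- At unit vectors the hypothesis on `A` is a closed half-space condition on `W(A)`, so it passes
  -- to the closed convex hull.
  have h : -μ₀.re ≤ reWeightedSum μ fun i => inner ℂ y (B i y) := by
    refine le_of_mem_closure_convexHull _ (fun a ha => ?_) (hW ⟨y, hy, fun _ => rfl⟩)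
    obtain ⟨z, hz, ha⟩ := ha
    have := hμ z
    rw [inner_operatorCombination, hz, mul_one, Complex.add_re] at this
    rw [reWeightedSum_apply]
    simp only [ha]
    linarith
  rw [reWeightedSum_apply] at h
  have hB : 0 ≤ (inner ℂ y (operatorCombination B (μ₀, μ) y)).re := by
    rw [inner_operatorCombination, hy, mul_one, Complex.add_re]
    linarith
  rw [map_smul, inner_smul_left, inner_smul_right, Complex.conj_ofReal, Complex.re_ofReal_mul,
    Complex.re_ofReal_mul]
  rw [← mul_assoc]
  exact mul_nonneg (mul_self_nonneg r) hB

lemma exists_isInducedMap_of_jointNumericalRange_subset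
    {A : Fin m → (H →L[ℂ] H)} {B : Fin m → (K →L[ℂ] K)}
    (hW : jointNumericalRange B ⊆ closure (convexHull ℝ (jointNumericalRange A))) :
    ∃ Φ : operatorSpan A →ₗ[ℂ] (K →L[ℂ] K), IsInducedMap A B Φ := by
  refine IsInducedMap.exists_of_ker_le fun μ hμ => ?_
  -- Every multiple `c • μ` also lies in the kernel; `c = ±1` and `c = ±I` then force both parts of
  -- the form to vanish.
  have key (c : ℂ) (x : K) : 0 ≤ (c * inner ℂ x (operatorCombination B μ x)).re := by
    have := re_inner_operatorCombination_nonneg hW (μ := c • μ) (by simp [hμ]) x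
    simpa [inner_smul_right] using this
  refine ContinuousLinearMap.eq_zero_of_inner_right fun x => ?_
  have h1 := key 1 x
  have h2 := key (-1) x
  have h3 := key Complex.I x
  have h4 := key (-Complex.I) x
  simp at h1 h2 h3 h4
  exact Complex.ext (le_antisymm h2 h1) (le_antisymm h3 h4)

/-- Numerical ranges of self-adjoint tuples consist of real points, where `f` acts through the real
coefficients `f(e_i)`; real coefficients keep the resulting combination self-adjoint. -/
lemma functional_eq_re_sum (f : (Fin m → ℂ) →L[ℝ] ℝ) {a : Fin m → ℂ} (ha : ∀ i, (a i).im = 0) :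
    f a = (∑ i, (f (Pi.single i 1) : ℂ) * a i).re := by
  have : a = ∑ i, (a i).re • (Pi.single i 1 : Fin m → ℂ) := by
    funext j
    simp only [Finset.sum_apply, Pi.smul_apply, Pi.single_apply, smul_ite, smul_zero,
      Finset.sum_ite_eq, Finset.mem_univ, if_true]
    exact Complex.ext (by simp) (by simp [ha])
  conv_lhs => rw [this]
  simp [mul_comm]

lemma re_inner_operatorCombination_eq [CompleteSpace H] {T : Fin m → (H →L[ℂ] H)}
    (hT : ∀ i, IsSelfAdjoint (T i)) (f : (Fin m → ℂ) →L[ℝ] ℝ) (c : ℝ) {z : H}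
    (hz : inner ℂ z z = (1 : ℂ)) :
    (inner ℂ z (operatorCombination T ((-c : ℂ), fun i => (f (Pi.single i 1) : ℂ)) z)).re =
      f (fun i => inner ℂ z (T i z)) - c := by
  rw [inner_operatorCombination, hz, mul_one, Complex.add_re,
    functional_eq_re_sum f fun i => (hT i).inner_self_im z, Complex.neg_re, Complex.ofReal_re]
  ring

variable [CompleteSpace H] [CompleteSpace K]

lemma isPositiveMap_of_jointNumericalRange_subset
    {A : Fin m → (H →L[ℂ] H)} {B : Fin m → (K →L[ℂ] K)}
    (hA : ∀ i, IsSelfAdjoint (A i)) (hB : ∀ i, IsSelfAdjoint (B i))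
    {Φ : operatorSpan A →ₗ[ℂ] (K →L[ℂ] K)} (hΦ : IsInducedMap A B Φ)
    (hW : jointNumericalRange B ⊆ closure (convexHull ℝ (jointNumericalRange A))) :
    IsPositiveMap Φ := by
  intro X hX
  obtain ⟨μ₀, μ, hμ⟩ := mem_operatorSpan_iff.1 X.2
  -- Conjugated coefficients represent the same `X`, so `Φ` gives the same value for both.
  have hself : star (Φ X) = Φ X := by
    have h : (X : H →L[ℂ] H) = operatorCombination A (star (μ₀, μ)) := by
      rw [← star_operatorCombination hA, ← hμ, hX.isSelfAdjoint.star_eq]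
    conv_lhs => rw [hΦ.apply_operatorCombination X hμ, star_operatorCombination hB]
    rw [hΦ.apply_operatorCombination X h]
  rw [ContinuousLinearMap.isPositive_iff_inner_right] at hX ⊢
  refine fun x => ⟨?_, IsSelfAdjoint.inner_self_im hself x⟩
  rw [hΦ.apply_operatorCombination X hμ]
  exact re_inner_operatorCombination_nonneg hW (fun y => hμ ▸ (hX y).1) x

lemma jointNumericalRange_subset_of_isPositiveMap
    {A : Fin m → (H →L[ℂ] H)} {B : Fin m → (K →L[ℂ] K)}
    (hA : ∀ i, IsSelfAdjoint (A i)) (hB : ∀ i, IsSelfAdjoint (B i))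
    {Φ : operatorSpan A →ₗ[ℂ] (K →L[ℂ] K)} (hΦ : IsInducedMap A B Φ) (hpos : IsPositiveMap Φ) :
    jointNumericalRange B ⊆ closure (convexHull ℝ (jointNumericalRange A)) := by
  rintro b ⟨y, hy, hb⟩
  by_contra hmem
  obtain ⟨f, c, hfb, hfa⟩ := geometric_hahn_banach_point_closed
    (convex_convexHull ℝ (jointNumericalRange A)).closure isClosed_closure hmem
  have hstar : star ((-c : ℂ), fun i => (f (Pi.single i 1) : ℂ)) =
      ((-c : ℂ), fun i => (f (Pi.single i 1) : ℂ)) := by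
    ext <;> simp
  set μ : ℂ × (Fin m → ℂ) := ((-c : ℂ), fun i => (f (Pi.single i 1) : ℂ)) with hμ
  have hX : (operatorCombination A μ).IsPositive := by
    rw [ContinuousLinearMap.isPositive_iff_inner_right]
    intro x
    refine ⟨?_, IsSelfAdjoint.inner_self_im
      (by rw [IsSelfAdjoint, star_operatorCombination hA, hstar]) x⟩
    rcases eq_or_ne x 0 with rfl | hx
    · simp
    obtain ⟨r, z, hz, rfl⟩ := exists_inner_self_eq_one_smul hx
    rw [map_smul, inner_smul_left, inner_smul_right, Complex.conj_ofReal, Complex.re_ofReal_mul,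
      Complex.re_ofReal_mul, ← mul_assoc, hμ, re_inner_operatorCombination_eq hA f c hz]
    refine mul_nonneg (mul_self_nonneg r) ?_
    have := hfa _ (subset_closure (subset_convexHull ℝ _ ⟨z, hz, fun _ => rfl⟩))
    linarith
  have := ContinuousLinearMap.isPositive_iff_inner_right.1
    (hpos ⟨_, mem_operatorSpan_iff.2 ⟨_, _, rfl⟩⟩ hX) y
  rw [hΦ.apply_operatorCombination _ rfl] at this
  have h2 := re_inner_operatorCombination_eq hB f c hy
  rw [← funext hb] at h2
  rw [← hμ] at h2
  linarith [this.1]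

end

/-! ### Tensor dilations and complete positivity -/

section

variable {H : Type u} {K : Type v} {L : Type w}
  [NormedAddCommGroup H] [InnerProductSpace ℂ H]
  [NormedAddCommGroup K] [InnerProductSpace ℂ K]
  [NormedAddCommGroup L] [InnerProductSpace ℂ L] {m : ℕ}

lemma inner_blockOperator {k : ℕ} (M : Matrix (Fin k) (Fin k) (H →L[ℂ] H))
    (x : PiLp 2 (fun _ : Fin k => H)) :
    inner ℂ x (blockOperator M x) = ∑ i, ∑ j, inner ℂ (x i) (M i j (x j)) := by
  simp [blockOperator, PiLp.inner_apply, inner_sum]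

lemma blockOperator_isPositive_iff {k : ℕ} {M : Matrix (Fin k) (Fin k) (H →L[ℂ] H)} :
    (blockOperator M).IsPositive ↔ ∀ x : Fin k → H,
      0 ≤ (∑ i, ∑ j, inner ℂ (x i) (M i j (x j))).re ∧
        (∑ i, ∑ j, inner ℂ (x i) (M i j (x j))).im = 0 := by
  rw [ContinuousLinearMap.isPositive_iff_inner_right]
  simp only [inner_blockOperator]
  exact ⟨fun h x => h (WithLp.toLp 2 x), fun h x => h x⟩

lemma tensorId_coe (T : H →L[ℂ] H) (x : H ⊗[ℂ] L) :
    tensorId L T (x : HilbertTensor H L) =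
      ((TensorProduct.map (T : H →ₗ[ℂ] H) LinearMap.id x : H ⊗[ℂ] L) : HilbertTensor H L) := by
  simp [tensorId]

lemma HilbertTensor.clm_ext {S T : HilbertTensor H L →L[ℂ] HilbertTensor H L}
    (h : ∀ x : H ⊗[ℂ] L, S (x : HilbertTensor H L) = T (x : HilbertTensor H L)) : S = T :=
  DFunLike.coe_injective <| UniformSpace.Completion.denseRange_coe.equalizer S.continuous
    T.continuous (funext h)

variable (H L) in
/-- The linear map `T ↦ T ⊗ I`. -/
noncomputable def tensorIdₗ :
    (H →L[ℂ] H) →ₗ[ℂ] (HilbertTensor H L →L[ℂ] HilbertTensor H L) where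
  toFun T := tensorId L T
  map_add' S T := HilbertTensor.clm_ext fun x => by
    rw [add_apply, tensorId_coe, tensorId_coe, tensorId_coe, ← UniformSpace.Completion.coe_add]
    simp [TensorProduct.map_add_left]
  map_smul' c T := HilbertTensor.clm_ext fun x => by
    rw [RingHom.id_apply, smul_apply, tensorId_coe, tensorId_coe,
      ← UniformSpace.Completion.coe_smul]
    simp [TensorProduct.map_smul_left]

lemma tensorIdₗ_apply (T : H →L[ℂ] H) : tensorIdₗ H L T = tensorId L T := rfl

lemma tensorId_one : tensorId L (1 : H →L[ℂ] H) = 1 := HilbertTensor.clm_ext fun x => by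
  have h : TensorProduct.map ((1 : H →L[ℂ] H) : H →ₗ[ℂ] H) (LinearMap.id : L →ₗ[ℂ] L) =
    LinearMap.id := TensorProduct.map_id
  rw [tensorId_coe, h]
  rfl

/-- Finitely many algebraic tensors can be expanded along a common finite orthonormal family. -/
lemma TensorProduct.exists_orthonormal_expansion {ι : Type*} [Finite ι] (x : ι → H ⊗[ℂ] L) :
    ∃ (n : ℕ) (e : Fin n → L) (h : ι → Fin n → H), Orthonormal ℂ e ∧
      ∀ i, x i = ∑ a, h i a ⊗ₜ[ℂ] e a := by
  obtain ⟨N, hN, hsub⟩ := TensorProduct.exists_finite_submodule_right_of_setFinite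
    (Set.range x) (Set.finite_range x)
  let b := stdOrthonormalBasis ℂ N
  choose y hy using fun i => hsub ⟨i, rfl⟩
  refine ⟨_, fun a => (b a : L),
    fun i a => TensorProduct.equivFinsuppOfBasisRight b.toBasis (y i) a,
    b.orthonormal.comp_linearIsometry N.subtypeₗᵢ, fun i => ?_⟩
  have := (TensorProduct.equivFinsuppOfBasisRight b.toBasis).symm_apply_apply (y i)
  rw [TensorProduct.equivFinsuppOfBasisRight_symm_apply] at this
  rw [← hy, ← this, Finsupp.sum_fintype _ _ (by simp)]
  simp

/-- Both conditions are closed, so algebraic tensors suffice; along a common orthonormal family the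
form splits into a sum of forms of `M` on `H^k`. -/
lemma sum_inner_tensorId_nonneg {k : ℕ} {M : Matrix (Fin k) (Fin k) (H →L[ℂ] H)}
    (hM : (blockOperator M).IsPositive) (x : Fin k → HilbertTensor H L) :
    0 ≤ (∑ i, ∑ j, inner ℂ (x i) (tensorId L (M i j) (x j))).re ∧
      (∑ i, ∑ j, inner ℂ (x i) (tensorId L (M i j) (x j))).im = 0 := by
  have hd : DenseRange fun (y : Fin k → H ⊗[ℂ] L) i => (y i : HilbertTensor H L) :=
    DenseRange.piMap fun _ => UniformSpace.Completion.denseRange_coe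
  refine isClosed_property hd (p := fun x : Fin k → HilbertTensor H L =>
    0 ≤ (∑ i, ∑ j, inner ℂ (x i) (tensorId L (M i j) (x j))).re ∧
      (∑ i, ∑ j, inner ℂ (x i) (tensorId L (M i j) (x j))).im = 0) ?_ (fun y => ?_) x
  · have hc : Continuous fun x : Fin k → HilbertTensor H L =>
        ∑ i, ∑ j, inner ℂ (x i) (tensorId L (M i j) (x j)) := by fun_prop
    exact (isClosed_le continuous_const (Complex.continuous_re.comp hc)).inter
      (isClosed_eq (Complex.continuous_im.comp hc) continuous_const)
  · obtain ⟨n, e, h, he, hy⟩ := TensorProduct.exists_orthonormal_expansion y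
    have key : ∑ i, ∑ j, inner ℂ (y i : HilbertTensor H L)
        (tensorId L (M i j) (y j : HilbertTensor H L)) =
        ∑ a, ∑ i, ∑ j, inner ℂ (h i a) (M i j (h j a)) := by
      have hij (i j : Fin k) : inner ℂ (y i : HilbertTensor H L)
          (tensorId L (M i j) (y j : HilbertTensor H L)) =
          ∑ a, inner ℂ (h i a) (M i j (h j a)) := by
        rw [tensorId_coe, UniformSpace.Completion.inner_coe, hy, hy]
        simp [sum_inner, inner_sum, orthonormal_iff_ite.1 he]
      simp only [hij]
      simp only [Finset.sum_comm (s := Finset.univ (α := Fin k)) (t := Finset.univ (α := Fin n))]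
    rw [key, Complex.re_sum, Complex.im_sum]
    have hp a := blockOperator_isPositive_iff.1 hM fun i => h i a
    exact ⟨Finset.sum_nonneg fun a _ => (hp a).1, Finset.sum_eq_zero fun a _ => (hp a).2⟩

lemma inner_tensorId_operatorCombination [CompleteSpace K] {A : Fin m → (H →L[ℂ] H)}
    {B : Fin m → (K →L[ℂ] K)} {V : K →ₗᵢ[ℂ] HilbertTensor H L}
    (hV : ∀ j, ContinuousLinearMap.adjoint V.toContinuousLinearMap ∘L tensorId L (A j) ∘L
      V.toContinuousLinearMap = B j) (μ : ℂ × (Fin m → ℂ)) (x y : K) :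
    inner ℂ (V x) (tensorId L (operatorCombination A μ) (V y)) =
      inner ℂ x (operatorCombination B μ y) := by
  obtain ⟨μ₀, μ⟩ := μ
  have hB (j) : inner ℂ (V x) (tensorId L (A j) (V y)) = inner ℂ x (B j y) := by
    rw [← hV j]
    simp [ContinuousLinearMap.adjoint_inner_right]
  rw [← tensorIdₗ_apply, operatorCombination_apply, operatorCombination_apply]
  simp only [map_add, map_smul, map_sum]
  simp [tensorIdₗ_apply, tensorId_one, inner_add_right, inner_sum, inner_smul_right, hB]

variable [CompleteSpace K]

lemma exists_isInducedMap_of_hasTensorDilation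
    {A : Fin m → (H →L[ℂ] H)} {B : Fin m → (K →L[ℂ] K)} (h : HasTensorDilation.{u, v, w} B A) :
    ∃ Φ : operatorSpan A →ₗ[ℂ] (K →L[ℂ] K), IsInducedMap A B Φ := by
  obtain ⟨L, _, _, _, V, hV⟩ := h
  refine IsInducedMap.exists_of_ker_le fun μ hμ => ?_
  refine ContinuousLinearMap.eq_zero_of_inner_right fun x => ?_
  rw [← inner_tensorId_operatorCombination hV, hμ, ← tensorIdₗ_apply, map_zero]
  simp

lemma isCompletelyPositiveMap_of_hasTensorDilation
    {A : Fin m → (H →L[ℂ] H)} {B : Fin m → (K →L[ℂ] K)}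
    {Φ : operatorSpan A →ₗ[ℂ] (K →L[ℂ] K)} (hΦ : IsInducedMap A B Φ)
    (h : HasTensorDilation.{u, v, w} B A) : IsCompletelyPositiveMap Φ := by
  obtain ⟨L, _, _, _, V, hV⟩ := h
  intro k M hM
  rw [blockOperator_isPositive_iff]
  intro x
  have key (i j) : inner ℂ (x i) (Φ (M i j) (x j)) =
      inner ℂ (V (x i)) (tensorId L (M i j : H →L[ℂ] H) (V (x j))) := by
    obtain ⟨μ₀, μ, hμ⟩ := mem_operatorSpan_iff.1 (M i j).2
    rw [hΦ.apply_operatorCombination _ hμ, hμ, inner_tensorId_operatorCombination hV]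
  simpa [key] using sum_inner_tensorId_nonneg hM fun i => V (x i)

end

/-! ### Gram vectors, cone extension and isometries -/

section

open ComplexConjugate

/-- A positive semidefinite scalar kernel is a Gram kernel. -/
lemma exists_gram_of_posSemidef_kernel {X : Type v} (k : X → X → ℂ)
    (hherm : ∀ x y, conj (k x y) = k y x)
    (hpos : ∀ (s : Finset X) (c : X → ℂ),
      0 ≤ (∑ x ∈ s, ∑ y ∈ s, conj (c x) * c y * k x y).re) :
    ∃ (L : Type v) (_ : NormedAddCommGroup L) (_ : InnerProductSpace ℂ L) (_ : CompleteSpace L)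
      (f : X → L), ∀ x y, inner ℂ (f x) (f y) = k x y := by
  -- Scalars become operators on `ℂ`, so that the Gram vectors are the kernel functions applied to
  -- `1`.
  let M : Matrix X X (ℂ →L[ℂ] ℂ) := fun x y => k x y • ContinuousLinearMap.id ℂ ℂ
  have hMapply (x y : X) (z : ℂ) : M x y z = k x y * z := rfl
  have hM : M.IsHermitian := by
    ext x y
    change ContinuousLinearMap.adjoint (M y x) 1 = M x y 1
    refine ext_inner_left ℂ fun z => ?_
    rw [ContinuousLinearMap.adjoint_inner_right]
    simp only [hMapply, RCLike.inner_apply, map_mul, hherm]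
    ring
  have hps : Fact M.PosSemidef := ⟨by
    have h := (RKHS.posSemidef_tfae (K := M)).out 2 0
    refine h.1 ⟨hM, fun c => ?_⟩
    refine (hpos c.support c).trans_eq (congrArg Complex.re ?_)
    simp only [Finsupp.sum, hMapply, RCLike.inner_apply, map_mul, hherm]
    refine Finset.sum_congr rfl fun x _ => Finset.sum_congr rfl fun y _ => ?_
    ring⟩
  refine ⟨RKHS.OfKernel M, inferInstance, inferInstance, inferInstance,
    fun x => RKHS.kerFun (RKHS.OfKernel M) x 1, fun x y => ?_⟩
  have h := RKHS.kernel_inner (RKHS.OfKernel M) y x (1 : ℂ) (1 : ℂ)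
  rw [RKHS.OfKernel.kernel_ofKernel] at h
  rw [← h, hMapply, RCLike.inner_apply, mul_one, one_mul, hherm]

/-- The complex form of the Riesz extension theorem, for a cone cut out by linear functionals. -/
lemma exists_linearMap_extension_re_nonneg {E ι : Type*} [AddCommGroup E] [Module ℂ E]
    (Q : ι → E →ₗ[ℂ] ℂ) (p : Submodule ℂ E) (s : E →ₗ[ℂ] ℂ)
    (hs : ∀ x ∈ p, (∀ i, 0 ≤ (Q i x).re) → 0 ≤ (s x).re)
    (hd : ∀ y, ∃ x ∈ p, ∀ i, 0 ≤ (Q i (x + y)).re) :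
    ∃ τ : E →ₗ[ℂ] ℂ, (∀ x ∈ p, τ x = s x) ∧ ∀ y, (∀ i, 0 ≤ (Q i y).re) → 0 ≤ (τ y).re := by
  let : Module ℝ E := Module.complexToReal E
  have : IsScalarTower ℝ ℂ E := inferInstance
  let C : PointedCone ℝ E :=
    { carrier := {y | ∀ i, 0 ≤ (Q i y).re}
      add_mem' := fun {a b} ha hb i => by
        rw [map_add, Complex.add_re]; exact add_nonneg (ha i) (hb i)
      zero_mem' := fun i => by simp
      smul_mem' := fun c x hx i => by
        have : (Q i (c • x)) = ((c : ℝ) : ℂ) • Q i x := by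
          rw [← map_smul]; rfl
        rw [this, smul_eq_mul, Complex.re_ofReal_mul]
        exact mul_nonneg c.2 (hx i) }
  let f : E →ₗ.[ℝ] ℝ := ⟨p.restrictScalars ℝ,
    Complex.reLm ∘ₗ (s.restrictScalars ℝ) ∘ₗ (p.restrictScalars ℝ).subtype⟩
  obtain ⟨g, hg, hgC⟩ := riesz_extension C f (fun x hx => hs x x.2 hx) fun y => by
    obtain ⟨x, hx, h⟩ := hd y
    exact ⟨⟨x, hx⟩, h⟩
  have hgp (x) (hx : x ∈ p) : g x = (s x).re := hg ⟨x, hx⟩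
  have hre (x) : (Module.Dual.extendRCLike (𝕜 := ℂ) g x).re = g x := by
    rw [← RCLike.re_to_complex, Module.Dual.re_extendRCLike_apply]
  have him (x) : (Module.Dual.extendRCLike (𝕜 := ℂ) g x).im = -g (Complex.I • x) := by
    rw [← RCLike.im_to_complex, Module.Dual.im_extendRCLike_apply, RCLike.I_to_complex]
  -- The complex functional is `g x - I * g (I • x)`; it equals `s` on `p` because `p` is stable
  -- under `I`.
  refine ⟨Module.Dual.extendRCLike (𝕜 := ℂ) g, fun x hx => ?_, fun y hy => ?_⟩
  · refine Complex.ext ?_ ?_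
    · rw [hre, hgp x hx]
    · rw [him, hgp _ (p.smul_mem _ hx)]
      simp
  · rw [hre]
    exact hgC y hy

/-- A functional nonnegative on the cone respects the conjugation relation. -/
lemma conj_eq_of_re_nonneg {E ι : Type*} [AddCommGroup E] [Module ℂ E]
    {Q : ι → E →ₗ[ℂ] ℂ} {τ : E →ₗ[ℂ] ℂ} (hτ : ∀ y, (∀ i, 0 ≤ (Q i y).re) → 0 ≤ (τ y).re)
    {y z : E} (h : ∀ i, conj (Q i y) = Q i z) : conj (τ y) = τ z := by
  have hre i : (Q i z).re = (Q i y).re := by rw [← h]; simp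
  have him i : (Q i z).im = -(Q i y).im := by rw [← h]; simp
  -- All `Q i` have zero real part on `y - z` and on `I • (y + z)`, so the cone contains both of
  -- these and their negatives.
  have h1 := hτ (y - z) fun i => by simp [hre]
  have h2 := hτ (z - y) fun i => by simp [hre]
  have h3 := hτ (Complex.I • (y + z)) fun i => by simp [him]
  have h4 := hτ (-(Complex.I • (y + z))) fun i => by simp [him]
  simp at h1 h2 h3 h4
  refine Complex.ext ?_ ?_
  · simp; linarith
  · simp; linarith

/-- A map preserving inner products is a linear isometry. -/
lemma exists_linearIsometry_of_inner_map {K G : Type*}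
    [NormedAddCommGroup K] [InnerProductSpace ℂ K] [NormedAddCommGroup G] [InnerProductSpace ℂ G]
    (f : K → G) (hf : ∀ x y, inner ℂ (f x) (f y) = inner ℂ x y) :
    ∃ V : K →ₗᵢ[ℂ] G, ∀ x, V x = f x := by
  let F : K →ₗ[ℂ] G :=
    { toFun := f
      map_add' := fun x y => by
        -- The squared norm of the defect from additivity involves only inner products of values of
        -- `f`, which are those in `K`.
        rw [← sub_eq_zero, ← inner_self_eq_zero (𝕜 := ℂ)]
        simp only [inner_sub_left, inner_sub_right, inner_add_left, inner_add_right, hf]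
        ring
      map_smul' := fun c x => by
        rw [← sub_eq_zero, ← inner_self_eq_zero (𝕜 := ℂ), RingHom.id_apply]
        simp only [inner_sub_left, inner_sub_right, inner_smul_left, inner_smul_right, hf]
        ring }
  exact ⟨F.isometryOfInner hf, fun x => rfl⟩

end

/-! ### Forms of finitely supported operator matrices -/

section

open ComplexConjugate

variable {H : Type u} {K : Type v}
  [NormedAddCommGroup H] [InnerProductSpace ℂ H]
  [NormedAddCommGroup K] [InnerProductSpace ℂ K] {ι : Type*}

/-- The linear functional `Y ↦ ∑ ⟨Y_{αβ} h_β, h_α⟩` on finitely supported matrices. -/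
noncomputable def matrixForm (h : ι → H) : ((ι × ι) →₀ (H →L[ℂ] H)) →ₗ[ℂ] ℂ :=
  Finsupp.lsum ℂ fun p => (innerSL ℂ (h p.1)).toLinearMap ∘ₗ
    (ContinuousLinearMap.apply ℂ H (h p.2)).toLinearMap

lemma matrixForm_apply (h : ι → H) (Y : (ι × ι) →₀ (H →L[ℂ] H)) :
    matrixForm h Y = Y.sum fun p T => inner ℂ (h p.1) (T (h p.2)) := rfl

lemma matrixForm_single (h : ι → H) (p : ι × ι) (T : H →L[ℂ] H) :
    matrixForm h (Finsupp.single p T) = inner ℂ (h p.1) (T (h p.2)) := by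
  rw [matrixForm_apply, Finsupp.sum_single_index (by simp)]

lemma matrixForm_eq_sum [DecidableEq ι] {k : ℕ} (e : Fin k ↪ ι) {Y : (ι × ι) →₀ (H →L[ℂ] H)}
    (hY : Y.support ⊆ Finset.univ.map e ×ˢ Finset.univ.map e) (h : ι → H) :
    matrixForm h Y = ∑ i, ∑ j, inner ℂ (h (e i)) (Y (e i, e j) (h (e j))) := by
  rw [matrixForm_apply, Finsupp.sum_of_support_subset _ hY _ (by simp), Finset.sum_product]
  simp

lemma Finsupp.exists_embedding_support_subset {α : Type*} [Zero α] [DecidableEq ι]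
    (Y : (ι × ι) →₀ α) :
    ∃ (k : ℕ) (e : Fin k ↪ ι), Y.support ⊆ Finset.univ.map e ×ˢ Finset.univ.map e := by
  let F := Y.support.image Prod.fst ∪ Y.support.image Prod.snd
  refine ⟨F.card, F.equivFin.symm.toEmbedding.trans (Function.Embedding.subtype _), ?_⟩
  have hF : Finset.univ.map (F.equivFin.symm.toEmbedding.trans (Function.Embedding.subtype _)) =
      F := by
    rw [← Finset.map_map, Finset.map_univ_equiv]
    ext; simp
  rw [hF]
  intro p hp
  simp only [Finset.mem_product, F, Finset.mem_union, Finset.mem_image]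
  exact ⟨Or.inl ⟨p, hp, rfl⟩, Or.inr ⟨p, hp, rfl⟩⟩

/-- Cauchy–Schwarz with `2‖x‖‖y‖ ≤ ‖x‖² + ‖y‖²`: diagonal multiples of `1` dominate an off-diagonal
entry. -/
lemma re_inner_add_norm_nonneg (T : H →L[ℂ] H) (x y : H) :
    0 ≤ ‖T‖ * (‖x‖ ^ 2 + ‖y‖ ^ 2) + (inner ℂ x (T y)).re := by
  have h1 : ‖inner ℂ x (T y)‖ ≤ ‖x‖ * (‖T‖ * ‖y‖) :=
    (norm_inner_le_norm x _).trans (by gcongr; exact T.le_opNorm y)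
  have h2 := (abs_le.1 (Complex.abs_re_le_norm (inner ℂ x (T y)))).1
  nlinarith [norm_nonneg T, sq_nonneg (‖x‖ - ‖y‖), mul_nonneg (norm_nonneg T)
    (sq_nonneg (‖x‖ - ‖y‖)), mul_nonneg (norm_nonneg T) (add_nonneg (sq_nonneg ‖x‖)
    (sq_nonneg ‖y‖))]

/-- Every finitely supported matrix becomes positive after adding a diagonal one with entries in
a subspace containing the identity. -/
lemma exists_add_matrixForm_nonneg {S : Submodule ℂ (H →L[ℂ] H)} (hS : 1 ∈ S)
    (Y : (ι × ι) →₀ (H →L[ℂ] H)) :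
    ∃ X : (ι × ι) →₀ (H →L[ℂ] H), (∀ p, X p ∈ S) ∧
      ∀ h : ι → H, 0 ≤ (matrixForm h (X + Y)).re := by
  classical
  induction Y using Finsupp.induction_linear with
  | zero => exact ⟨0, by simp, by simp⟩
  | add Y Z hY hZ =>
    obtain ⟨X, hXS, hX⟩ := hY
    obtain ⟨X', hXS', hX'⟩ := hZ
    refine ⟨X + X', fun p => S.add_mem (hXS p) (hXS' p), fun h => ?_⟩
    rw [add_add_add_comm, map_add, Complex.add_re]
    exact add_nonneg (hX h) (hX' h)
  | single p T =>
    have hsm (q r : ι × ι) : Finsupp.single q ((‖T‖ : ℂ) • (1 : H →L[ℂ] H)) r ∈ S := by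
      rw [Finsupp.single_apply]
      split_ifs
      exacts [S.smul_mem _ hS, S.zero_mem]
    refine ⟨Finsupp.single (p.1, p.1) ((‖T‖ : ℂ) • 1) + Finsupp.single (p.2, p.2) ((‖T‖ : ℂ) • 1),
      fun q => S.add_mem (hsm _ q) (hsm _ q), fun h => ?_⟩
    have := re_inner_add_norm_nonneg T (h p.1) (h p.2)
    simp only [map_add, matrixForm_single, smul_apply, one_apply_eq_self, inner_smul_right,
      inner_self_eq_norm_sq_to_K, Complex.add_re, Complex.re_ofReal_mul]
    simp only [Complex.coe_algebraMap, ← Complex.ofReal_pow, Complex.ofReal_re]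
    linarith

end

/-! ### Gram vectors from positive functionals -/

section

open ComplexConjugate

variable {H : Type u} [NormedAddCommGroup H] [InnerProductSpace ℂ H] {ι : Type v}

/-- A positive functional on finitely supported operator matrices has Gram vectors. -/
lemma exists_gram_of_positive_functional {κ : Type} (e : κ → H)
    {τ : ((ι × ι) →₀ (H →L[ℂ] H)) →ₗ[ℂ] ℂ}
    (hτ : ∀ Y, (∀ h : ι → H, 0 ≤ (matrixForm h Y).re) → 0 ≤ (τ Y).re) :
    ∃ (L : Type v) (_ : NormedAddCommGroup L) (_ : InnerProductSpace ℂ L) (_ : CompleteSpace L)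
      (f : ι → κ → L), ∀ x y i j, inner ℂ (f x i) (f y j) =
        τ (Finsupp.single (x, y) (InnerProductSpace.rankOne ℂ (e i) (e j))) := by
  obtain ⟨L, i₁, i₂, i₃, f, hf⟩ := exists_gram_of_posSemidef_kernel (X := ι × κ)
    (fun a b => τ (Finsupp.single (a.1, b.1) (InnerProductSpace.rankOne ℂ (e a.2) (e b.2))))
    (fun a b => conj_eq_of_re_nonneg hτ fun h => by
      simp [matrixForm_single, mul_comm])
    (fun s c => by
      simp only [← smul_eq_mul, ← map_smul, ← map_sum]
      refine hτ _ fun h => ?_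
      -- Rank-one entries make the form a squared modulus `|∑ c_a ⟨e_a, h_a⟩|²`.
      have : matrixForm h (∑ a ∈ s, ∑ b ∈ s, (conj (c a) • c b) •
          Finsupp.single (a.1, b.1) (InnerProductSpace.rankOne ℂ (e a.2) (e b.2))) =
          conj (∑ a ∈ s, c a * inner ℂ (e a.2) (h a.1)) *
            ∑ b ∈ s, c b * inner ℂ (e b.2) (h b.1) := by
        simp only [map_sum, map_smul, matrixForm_single, Finset.sum_mul_sum, map_mul]
        refine Finset.sum_congr rfl fun a _ => Finset.sum_congr rfl fun b _ => ?_
        simp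
        ring
      rw [this, ← Complex.normSq_eq_conj_mul_self, Complex.ofReal_re]
      exact Complex.normSq_nonneg _)
  exact ⟨L, i₁, i₂, i₃, fun x i => f (x, i), fun x y i j => hf _ _⟩

lemma OrthonormalBasis.sum_inner_smul_rankOne {κ : Type*} [Fintype κ]
    (e : OrthonormalBasis κ ℂ H) (X : H →L[ℂ] H) :
    ∑ i, ∑ j, inner ℂ (e i) (X (e j)) • InnerProductSpace.rankOne ℂ (e i) (e j) = X := by
  ext z
  have hX : X z = ∑ j, inner ℂ (e j) z • X (e j) := by
    conv_lhs => rw [← e.sum_repr' z]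
    simp
  rw [hX, Finset.sum_comm]
  simp only [sum_apply, smul_apply, InnerProductSpace.rankOne_apply]
  refine Finset.sum_congr rfl fun j _ => ?_
  conv_rhs => rw [← e.sum_repr' (X (e j)), Finset.smul_sum]
  exact Finset.sum_congr rfl fun i _ => smul_comm _ _ _

end

/-! ### From complete positivity to a dilation -/

section

open ComplexConjugate

variable {H : Type u} {K : Type v}
  [NormedAddCommGroup H] [InnerProductSpace ℂ H] [CompleteSpace H]
  [NormedAddCommGroup K] [InnerProductSpace ℂ K] [CompleteSpace K] {m : ℕ}

lemma IsInducedMap.exists_star {A : Fin m → (H →L[ℂ] H)} {B : Fin m → (K →L[ℂ] K)}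
    (hA : ∀ i, IsSelfAdjoint (A i)) (hB : ∀ i, IsSelfAdjoint (B i))
    {Φ : operatorSpan A →ₗ[ℂ] (K →L[ℂ] K)} (hΦ : IsInducedMap A B Φ) (X : operatorSpan A) :
    ∃ Y : operatorSpan A, (Y : H →L[ℂ] H) = star (X : H →L[ℂ] H) ∧ Φ Y = star (Φ X) := by
  obtain ⟨μ₀, μ, hμ⟩ := mem_operatorSpan_iff.1 X.2
  refine ⟨⟨operatorCombination A (star (μ₀, μ)), mem_operatorSpan_iff.2 ⟨_, _, rfl⟩⟩, ?_, ?_⟩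
  · rw [hμ, star_operatorCombination hA]
  · rw [hΦ.apply_operatorCombination _ rfl, hΦ.apply_operatorCombination X hμ,
      star_operatorCombination hB]

lemma inner_star_right (T : H →L[ℂ] H) (x y : H) :
    inner ℂ x (star T y) = conj (inner ℂ y (T x)) := by
  rw [ContinuousLinearMap.star_eq_adjoint, ContinuousLinearMap.adjoint_inner_right, inner_conj_symm]

/-- Links the two notions of positivity: the cone constrains only real parts, while `IsPositive`
needs a real form, which symmetrizing provides. -/
lemma sum_inner_add_star {k : ℕ} (N : Fin k → Fin k → (H →L[ℂ] H)) (x : Fin k → H) :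
    ∑ i, ∑ j, inner ℂ (x i) ((N i j + star (N j i)) (x j)) =
      (2 * (∑ i, ∑ j, inner ℂ (x i) (N i j (x j))).re : ℝ) := by
  simp only [add_apply, inner_add_right, inner_star_right, Finset.sum_add_distrib]
  rw [Finset.sum_comm (f := fun i j => conj (inner ℂ (x j) (N j i (x i))))]
  simp only [← map_sum]
  rw [Complex.add_conj]

/-- Complete positivity passes to finitely supported matrices whose real part is positive. -/
lemma IsCompletelyPositiveMap.re_matrixForm_nonneg {S : Submodule ℂ (H →L[ℂ] H)}
    {Φ : S →ₗ[ℂ] (K →L[ℂ] K)} (hcp : IsCompletelyPositiveMap Φ)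
    (hstar : ∀ X : S, ∃ Y : S, (Y : H →L[ℂ] H) = star (X : H →L[ℂ] H) ∧ Φ Y = star (Φ X))
    {Ψ : (H →L[ℂ] H) →ₗ[ℂ] (K →L[ℂ] K)} (hΨ : ∀ X : S, Ψ X = Φ X) {ι : Type*}
    {Y : (ι × ι) →₀ (H →L[ℂ] H)} (hYS : ∀ p, Y p ∈ S)
    (hY : ∀ h : ι → H, 0 ≤ (matrixForm h Y).re) (g : ι → K) :
    0 ≤ (matrixForm g (Finsupp.mapRange.linearMap Ψ Y)).re := by
  classical
  obtain ⟨k, e, he⟩ := Finsupp.exists_embedding_support_subset Y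
  have he' : (Finsupp.mapRange.linearMap Ψ Y).support ⊆
      Finset.univ.map e ×ˢ Finset.univ.map e := (Finsupp.support_mapRange (hf := map_zero Ψ)).trans he
  choose st hst hΦst using hstar
  let M : Matrix (Fin k) (Fin k) S := Matrix.of fun i j =>
    ⟨Y (e i, e j), hYS _⟩ + st ⟨Y (e j, e i), hYS _⟩
  have hM : (blockOperator (M.map fun X => (X : H →L[ℂ] H))).IsPositive := by
    rw [blockOperator_isPositive_iff]
    intro x
    have := sum_inner_add_star (fun i j => Y (e i, e j)) x
    simp only [Matrix.map_apply, M, Matrix.of_apply, Submodule.coe_add, hst]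
    rw [this, Complex.ofReal_re, Complex.ofReal_im]
    refine ⟨?_, rfl⟩
    -- The support of `Y` lies over the range of `e`, so the value `0` elsewhere has no effect.
    have hq := hY (Function.extend e x 0)
    rw [matrixForm_eq_sum e he] at hq
    simp only [e.injective.extend_apply] at hq
    linarith
  have h := ((blockOperator_isPositive_iff.1 (hcp k M hM)) (g ∘ e)).1
  simp only [Matrix.map_apply, M, Matrix.of_apply, map_add, hΦst] at h
  simp only [← hΨ] at h
  rw [sum_inner_add_star (fun i j => Ψ (Y (e i, e j)))] at h
  rw [matrixForm_eq_sum e he']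
  simp only [Function.comp_apply, Complex.ofReal_re] at h
  simp only [Finsupp.mapRange.linearMap_apply, Finsupp.mapRange_apply]
  linarith

/-- A completely positive map on an operator system extends, at the level of forms, to a
positive functional on all finitely supported operator matrices. -/
lemma IsCompletelyPositiveMap.exists_extension {S : Submodule ℂ (H →L[ℂ] H)}
    {Φ : S →ₗ[ℂ] (K →L[ℂ] K)} (hcp : IsCompletelyPositiveMap Φ) (hS : 1 ∈ S)
    (hstar : ∀ X : S, ∃ Y : S, (Y : H →L[ℂ] H) = star (X : H →L[ℂ] H) ∧ Φ Y = star (Φ X)) :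
    ∃ τ : ((K × K) →₀ (H →L[ℂ] H)) →ₗ[ℂ] ℂ,
      (∀ (x y : K) (X : S), τ (Finsupp.single (x, y) (X : H →L[ℂ] H)) = inner ℂ x (Φ X y)) ∧
      ∀ Y, (∀ h : K → H, 0 ≤ (matrixForm h Y).re) → 0 ≤ (τ Y).re := by
  classical
  -- `Ψ` is any linear extension, with no positivity; it only serves to write the functional on the
  -- whole space, and is used only at entries in `S`.
  obtain ⟨Ψ, hΨ⟩ := Φ.exists_extend
  have hΨ' (X : S) : Ψ X = Φ X := LinearMap.congr_fun hΨ X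
  let p : Submodule ℂ ((K × K) →₀ (H →L[ℂ] H)) :=
    { carrier := {Y | ∀ q, Y q ∈ S}
      add_mem' := fun ha hb q => S.add_mem (ha q) (hb q)
      zero_mem' := fun q => S.zero_mem
      smul_mem' := fun c Y hY q => S.smul_mem c (hY q) }
  -- Rows and columns are indexed by vectors of `K`, so `matrixForm id` pairs the entry at `(x, y)`
  -- with `x` and `y` themselves.
  obtain ⟨τ, hτp, hτ⟩ := exists_linearMap_extension_re_nonneg
    (fun h : K → H => matrixForm h) p (matrixForm id ∘ₗ Finsupp.mapRange.linearMap Ψ)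
    (fun Y hYS hY => hcp.re_matrixForm_nonneg hstar hΨ' hYS hY id)
    (fun Y => exists_add_matrixForm_nonneg hS Y)
  refine ⟨τ, fun x y X => ?_, hτ⟩
  rw [hτp]
  · simp [matrixForm_single, hΨ']
  · intro q
    rw [Finsupp.single_apply]
    split_ifs
    exacts [X.2, S.zero_mem]

lemma hasTensorDilation_of_isCompletelyPositiveMap [FiniteDimensional ℂ H]
    {A : Fin m → (H →L[ℂ] H)} {B : Fin m → (K →L[ℂ] K)}
    (hA : ∀ i, IsSelfAdjoint (A i)) (hB : ∀ i, IsSelfAdjoint (B i))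
    {Φ : operatorSpan A →ₗ[ℂ] (K →L[ℂ] K)} (hΦ : IsInducedMap A B Φ)
    (hcp : IsCompletelyPositiveMap Φ) : HasTensorDilation.{u, v, v} B A := by
  have h1 : (1 : H →L[ℂ] H) ∈ operatorSpan A := Submodule.subset_span (Set.mem_insert _ _)
  have hAj (j) : A j ∈ operatorSpan A := Submodule.subset_span (Or.inr ⟨j, rfl⟩)
  have hΦ1 : Φ ⟨1, h1⟩ = 1 := by
    simpa using hΦ ⟨1, h1⟩ 1 0 (by simp)
  have hΦA (j) : Φ ⟨A j, hAj j⟩ = B j := by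
    classical
    simpa [Pi.single_apply] using hΦ ⟨A j, hAj j⟩ 0 (Pi.single j 1) (by simp [Pi.single_apply])
  obtain ⟨τ, hτS, hτ⟩ := hcp.exists_extension h1 (hΦ.exists_star hA hB)
  let e := stdOrthonormalBasis ℂ H
  obtain ⟨L, _, _, _, f, hf⟩ := exists_gram_of_positive_functional e hτ
  let V₀ : K → HilbertTensor H L := fun x => ((∑ i, e i ⊗ₜ[ℂ] f x i : H ⊗[ℂ] L) : _)
  -- Both sides equal `∑ ⟨e_i, X e_j⟩ ⟨f x i, f y j⟩`, the matrix-unit expansion of `τ` at `X`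
  -- placed in position `(x, y)`.
  have hV₀ (X : operatorSpan A) (x y : K) :
      inner ℂ (V₀ x) (tensorId L (X : H →L[ℂ] H) (V₀ y)) = inner ℂ x (Φ X y) := by
    rw [← hτS, ← e.sum_inner_smul_rankOne (X : H →L[ℂ] H), tensorId_coe,
      UniformSpace.Completion.inner_coe, e.sum_inner_smul_rankOne (X : H →L[ℂ] H)]
    simp only [map_sum, TensorProduct.map_tmul, sum_inner, inner_sum, TensorProduct.inner_tmul]
    conv_rhs => rw [← e.sum_inner_smul_rankOne (X : H →L[ℂ] H)]
    simp only [Finsupp.single_finsetSum, ← Finsupp.smul_single, map_sum, map_smul, ← hf]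
    rw [Finset.sum_comm]
    simp
  -- The case `X = 1` shows that `V₀` preserves inner products, which also yields its linearity.
  obtain ⟨V, hV⟩ := exists_linearIsometry_of_inner_map V₀ fun x y => by
    simpa [hΦ1, tensorId_one] using hV₀ ⟨1, h1⟩ x y
  refine ⟨L, inferInstance, inferInstance, inferInstance, V, fun j => ?_⟩
  ext y
  refine ext_inner_left ℂ fun x => ?_
  have := hV₀ ⟨A j, hAj j⟩ x y
  rw [hΦA, ← hV, ← hV] at this
  simpa [ContinuousLinearMap.adjoint_inner_right] using this

end

/-- The first two conjuncts say that the numerical range inclusion and the existence of a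
dilation each make the induced map `Φ` well defined. Dilation spaces may live in any
universe `w` when they are assumed, and are found in the universe of `K`. -/
theorem theorem2p2 {H : Type u} {K : Type v}
    [NormedAddCommGroup H] [InnerProductSpace ℂ H] [CompleteSpace H]
    [NormedAddCommGroup K] [InnerProductSpace ℂ K] [CompleteSpace K]
    (m : ℕ) (A : Fin m → (H →L[ℂ] H)) (B : Fin m → (K →L[ℂ] K))
    (hA : ∀ i, IsSelfAdjoint (A i)) (hB : ∀ i, IsSelfAdjoint (B i)) :
    (jointNumericalRange B ⊆ closure (convexHull ℝ (jointNumericalRange A)) →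
      ∃ Φ : operatorSpan A →ₗ[ℂ] (K →L[ℂ] K), IsInducedMap A B Φ) ∧
    (HasTensorDilation.{u, v, w} B A →
      ∃ Φ : operatorSpan A →ₗ[ℂ] (K →L[ℂ] K), IsInducedMap A B Φ) ∧
    ∀ Φ : operatorSpan A →ₗ[ℂ] (K →L[ℂ] K), IsInducedMap A B Φ →
      (IsPositiveMap Φ ↔
        jointNumericalRange B ⊆ closure (convexHull ℝ (jointNumericalRange A))) ∧
      (HasTensorDilation.{u, v, w} B A → IsCompletelyPositiveMap Φ) ∧
      (IsCompletelyPositiveMap Φ → FiniteDimensional ℂ H →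
        HasTensorDilation.{u, v, v} B A) := by
  refine ⟨exists_isInducedMap_of_jointNumericalRange_subset,
    exists_isInducedMap_of_hasTensorDilation, fun Φ hΦ => ⟨⟨?_, ?_⟩, ?_, ?_⟩⟩
  · exact jointNumericalRange_subset_of_isPositiveMap hA hB hΦ
  · exact isPositiveMap_of_jointNumericalRange_subset hA hB hΦ
  · exact isCompletelyPositiveMap_of_hasTensorDilation hΦ
  · intro hcp _
    exact hasTensorDilation_of_isCompletelyPositiveMap hA hB hΦ hcp
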